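/- Let $G$ be a complex Lie group (finite-dimensional), let $\sigma : G \to G$ be an antiholomorphic involution, i.e. an involutive automorphism of the group $G$ that is smooth for the underlying real Lie group structure and has complex-antilinear differential at every point, and let $H \subset G$ be a closed complex Lie subgroup. Equip the homogeneous space $X = G/H$ with its quotient complex manifold structure and with the action of $G$ by left translations. A $\sigma$-equivariant real structure on $X$ is an antiholomorphic diffeomorphism $\mu : X \to X$ such that $\mu \circ \mu = \mathrm{id}_X$ and $$\mu(g \cdot x) = \sigma(g) \cdot \mu(x) \quad \text{for all } g \in G,\ x \in X.$$ (1) If there exists a $\sigma$-equivariant real structure on $X$, then $\sigma(H)$ and $H$ are conjugate by an inner automorphism of $G$, i.e. $\sigma(H) = g_0 H g_0^{-1}$ for some $g_0 \in G$. (2) Conversely, if $\sigma(H) = g_0 H g_0^{-1}$ for some $g_0 \in G$ and $H$ is self-normalizing, i.e. $N_G(H) = H$, then there exists one and only one $\sigma$-equivariant real structure on $X$. -/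

import Mathlib

open scoped Manifold ContDiff Topology

noncomputable section

section Antiholomorphic

/-- The differential at `x` of a map between complex manifolds, as a real linear map between the
complex model spaces, which are identified with the tangent spaces through the preferred
holomorphic charts at `x` and at `f x`. -/
def realDifferential (E F : Type*) [NormedAddCommGroup E] [NormedSpace ℂ E]
    [NormedAddCommGroup F] [NormedSpace ℂ F]
    {M N : Type*} [TopologicalSpace M] [ChartedSpace E M] [TopologicalSpace N] [ChartedSpace F N]
    (f : M → N) (x : M) : E →L[ℝ] F :=
  mfderiv 𝓘(ℝ, E) 𝓘(ℝ, F) f x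

/-- A map between complex manifolds is antiholomorphic if it is smooth as a map of the underlying
real manifolds and its differential is antilinear with respect to the complex structures of the
tangent spaces. -/
def IsAntiholomorphic (E F : Type*) [NormedAddCommGroup E] [NormedSpace ℂ E]
    [NormedAddCommGroup F] [NormedSpace ℂ F]
    {M N : Type*} [TopologicalSpace M] [ChartedSpace E M] [TopologicalSpace N] [ChartedSpace F N]
    (f : M → N) : Prop :=
  ContMDiff 𝓘(ℝ, E) 𝓘(ℝ, F) ∞ f ∧
    ∀ (x : M) (v : E), realDifferential E F f x (Complex.I • v) =
      -(Complex.I • realDifferential E F f x v)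

/-- A real structure on a complex manifold: an antiholomorphic involutive diffeomorphism.
(A smooth involution is its own smooth inverse, hence a diffeomorphism.) -/
structure IsRealStructure (F : Type*) [NormedAddCommGroup F] [NormedSpace ℂ F]
    {X : Type*} [TopologicalSpace X] [ChartedSpace F X] (μ : X → X) : Prop where
  antiholomorphic : IsAntiholomorphic F F μ
  involutive : Function.Involutive μ

/-- A real structure `μ` on `X` that is compatible with a group action and `σ : G → G`. -/
structure IsEquivariantRealStructure (F : Type*) [NormedAddCommGroup F] [NormedSpace ℂ F]
    {G : Type*} [Group G] (σ : G →* G)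
    {X : Type*} [TopologicalSpace X] [ChartedSpace F X] [MulAction G X] (μ : X → X) : Prop
    extends IsRealStructure F μ where
  equivariant : ∀ (g : G) (x : X), μ (g • x) = σ g • μ x

end Antiholomorphic

section Quotient

variable {E : Type*} [NormedAddCommGroup E] [NormedSpace ℂ E]
variable {G : Type*} [Group G] [TopologicalSpace G] [ChartedSpace E G]

/-- A closed complex Lie subgroup: a closed subgroup which is a complex submanifold, i.e. around
each of its points there is a holomorphic chart of `G` in which it is a complex linear subspace. -/
structure IsClosedComplexLieSubgroup (E : Type*) [NormedAddCommGroup E] [NormedSpace ℂ E]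
    {G : Type*} [Group G] [TopologicalSpace G] [ChartedSpace E G] (H : Subgroup G) : Prop where
  isClosed : IsClosed (H : Set G)
  exists_slice : ∀ h ∈ H, ∃ e ∈ IsManifold.maximalAtlas 𝓘(ℂ, E) ω G, ∃ W : Submodule ℂ E,
    h ∈ e.source ∧ ∀ x ∈ e.source, x ∈ H ↔ e x ∈ W

variable [FiniteDimensional ℂ E] [LieGroup 𝓘(ℂ, E) ω G] {H : Subgroup G}

/-- Near the identity a holomorphic slice transversal to `H` is given by `s`, and `p` is the
holomorphic projection to the slice along the cosets of `H`. -/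
theorem IsClosedComplexLieSubgroup.exists_section (hH : IsClosedComplexLieSubgroup E H) :
    ∃ (V : Submodule ℂ E) (A : Set V) (N : Set G) (s : V → G) (p : G → V),
      IsOpen A ∧ 0 ∈ A ∧ IsOpen N ∧ s 0 = 1 ∧ Set.MapsTo s A N ∧
      ContMDiffOn 𝓘(ℂ, V) 𝓘(ℂ, E) ω s A ∧ ContMDiffOn 𝓘(ℂ, E) 𝓘(ℂ, V) ω p N ∧
      Set.InjOn (fun v => (s v : G ⧸ H)) A ∧
      (∀ g ∈ N, (s (p g) : G ⧸ H) = (g : G ⧸ H)) ∧ (∀ v ∈ A, p (s v) = v) := by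
  have : IsTopologicalGroup G := topologicalGroup_of_lieGroup 𝓘(ℂ, E) ω
  have : CompleteSpace E := FiniteDimensional.complete ℂ E
  obtain ⟨e, he, W, h1, hW⟩ := hH.exists_slice 1 H.one_mem
  obtain ⟨V, hVW⟩ := W.exists_isCompl
  have hWV : IsCompl V W := hVW.symm
  have : CompleteSpace V := FiniteDimensional.complete ℂ V
  have : CompleteSpace W := FiniteDimensional.complete ℂ W
  set w0 : E := e 1 with hw0
  have hw0W : w0 ∈ W := (hW 1 h1).1 H.one_mem
  have hw0t : w0 ∈ e.target := e.map_source h1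
  have hes : e.symm w0 = 1 := e.left_inv h1
  let S : E → G := fun v => e.symm (w0 + v)
  have hS0 : S 0 = 1 := by simp [S, hes]
  have hTopen : IsOpen {v : E | w0 + v ∈ e.target} :=
    e.open_target.preimage (continuous_const.add continuous_id)
  have hSsm : ContMDiffOn 𝓘(ℂ, E) 𝓘(ℂ, E) ω S {v : E | w0 + v ∈ e.target} :=
    (contMDiffOn_symm_of_mem_maximalAtlas he).comp
      ((contDiff_const.add contDiff_id).contMDiff.contMDiffOn) (fun v hv => hv)
  have hSat : ContMDiffAt 𝓘(ℂ, E) 𝓘(ℂ, E) ω S 0 :=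
    hSsm.contMDiffAt (hTopen.mem_nhds (by simpa using hw0t))
  have heS : ∀ v, w0 + v ∈ e.target → e (S v) = w0 + v := fun v hv => e.right_inv hv
  have hSsrc : ∀ v, w0 + v ∈ e.target → S v ∈ e.source := fun v hv => e.map_target hv
  have hSW : ∀ w : W, w0 + w ∈ e.target → S w ∈ H := fun w hw => by
    rw [hW _ (hSsrc _ hw), heS _ hw]; exact W.add_mem hw0W w.2
  let m : V × W → G := fun q => S q.1 * S q.2
  have hfst : ContMDiffAt 𝓘(ℂ, V × W) 𝓘(ℂ, E) ω (fun q : V × W => (q.1 : E)) 0 :=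
    (V.subtypeL.contDiff.comp contDiff_fst).contMDiff.contMDiffAt
  have hsnd : ContMDiffAt 𝓘(ℂ, V × W) 𝓘(ℂ, E) ω (fun q : V × W => (q.2 : E)) 0 :=
    (W.subtypeL.contDiff.comp contDiff_snd).contMDiff.contMDiffAt
  have hm : ContMDiffAt 𝓘(ℂ, V × W) 𝓘(ℂ, E) ω m 0 :=
    (ContMDiffAt.comp (g := S) (0 : V × W) (by simpa using hSat) hfst).mul
      (ContMDiffAt.comp (g := S) (0 : V × W) (by simpa using hSat) hsnd)
  have hm0 : m 0 = 1 := by simp [m, hS0]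
  let F : V × W → E := fun q => e (m q)
  have hF : ContDiffAt ℂ ω F 0 := by
    rw [← contMDiffAt_iff_contDiffAt]
    exact ContMDiffAt.comp (g := e) (0 : V × W)
      (contMDiffAt_of_mem_maximalAtlas he (by rw [hm0]; exact h1)) hm
  have hF0 : F 0 = w0 := by simp [F, hm0, hw0]
  -- `F` on the two factors
  have hFv : ∀ v : V, w0 + (v : E) ∈ e.target → F (v, 0) = w0 + v := fun v hv => by
    simp [F, m, hS0, heS _ hv]
  have hFw : ∀ w : W, w0 + (w : E) ∈ e.target → F (0, w) = w0 + w := fun w hw => by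
    simp [F, m, hS0, heS _ hw]
  have hFd : HasFDerivAt F (fderiv ℂ F 0) 0 := (hF.differentiableAt (by simp)).hasFDerivAt
  have hdv : ∀ v : V, fderiv ℂ F 0 (v, 0) = v := by
    have h1' : HasFDerivAt (fun v : V => F (v, 0))
        ((fderiv ℂ F 0).comp (ContinuousLinearMap.inl ℂ V W)) 0 :=
      HasFDerivAt.comp (g := F) (f := fun v : V => ((v, 0) : V × W)) (0 : V) hFd
        (ContinuousLinearMap.inl ℂ V W).hasFDerivAt
    have h2' : HasFDerivAt (fun v : V => F (v, 0)) V.subtypeL 0 := by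
      refine (V.subtypeL.hasFDerivAt.const_add w0).congr_of_eventuallyEq ?_
      filter_upwards [(hTopen.preimage V.subtypeL.continuous).mem_nhds
        (show (0 : V) ∈ _ by simpa using hw0t)] with v hv
      exact hFv v hv
    intro v
    simpa using congrArg (fun L : V →L[ℂ] E => L v) (h1'.unique h2')
  have hdw : ∀ w : W, fderiv ℂ F 0 (0, w) = w := by
    have h1' : HasFDerivAt (fun w : W => F (0, w))
        ((fderiv ℂ F 0).comp (ContinuousLinearMap.inr ℂ V W)) 0 :=
      HasFDerivAt.comp (g := F) (f := fun w : W => ((0, w) : V × W)) (0 : W) hFd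
        (ContinuousLinearMap.inr ℂ V W).hasFDerivAt
    have h2' : HasFDerivAt (fun w : W => F (0, w)) W.subtypeL 0 := by
      refine (W.subtypeL.hasFDerivAt.const_add w0).congr_of_eventuallyEq ?_
      filter_upwards [(hTopen.preimage W.subtypeL.continuous).mem_nhds
        (show (0 : W) ∈ _ by simpa using hw0t)] with w hw
      exact hFw w hw
    intro w
    simpa using congrArg (fun L : W →L[ℂ] E => L w) (h1'.unique h2')
  let L : (V × W) ≃L[ℂ] E := (V.prodEquivOfIsCompl W hWV).toContinuousLinearEquiv
  have hL : (L : V × W →L[ℂ] E) = fderiv ℂ F 0 := by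
    ext q
    · simpa [L] using (hdv _).symm
    · simpa [L] using (hdw _).symm
  have hFL : HasFDerivAt F (L : V × W →L[ℂ] E) 0 := by rw [hL]; exact hFd
  let Φ := hF.toOpenPartialHomeomorph F hFL (by simp)
  have hΦ0 : (0 : V × W) ∈ Φ.source := hF.mem_toOpenPartialHomeomorph_source hFL (by simp)
  have hΦc : ∀ q, Φ q = F q := fun q => rfl
  have hΦt : w0 ∈ Φ.target := by have := Φ.map_source hΦ0; rwa [hΦc, hF0] at this
  have hΦs0 : Φ.symm w0 = 0 := by have := Φ.left_inv hΦ0; rwa [hΦc, hF0] at this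
  have hΦsm : ContDiffAt ℂ ω Φ.symm w0 := by
    have := hF.to_localInverse hFL (by simp)
    rw [hF0] at this
    exact this
  -- neighbourhoods for the projection
  have hp_ev : ∀ᶠ g in 𝓝 (1 : G), g ∈ e.source ∧ e g ∈ Φ.target ∧
      ContDiffAt ℂ ω Φ.symm (e g) ∧
      w0 + ((Φ.symm (e g)).2 : E) ∈ e.target ∧ m (Φ.symm (e g)) ∈ e.source := by
    have hec : Filter.Tendsto e (𝓝 1) (𝓝 w0) := e.continuousAt h1
    have hΦec : Filter.Tendsto (fun g => Φ.symm (e g)) (𝓝 1) (𝓝 0) := by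
      have := (hΦsm.continuousAt.tendsto).comp hec
      rwa [hΦs0] at this
    refine Filter.Eventually.and (e.open_source.mem_nhds h1) ((hec.eventually (Φ.open_target.mem_nhds hΦt)).and
      ((hec.eventually (hΦsm.eventually (by simp))).and (.and ?_ ?_)))
    · exact hΦec.eventually ((hTopen.preimage
        (W.subtypeL.continuous.comp continuous_snd)).mem_nhds (by simpa using hw0t))
    · have := hm.continuousAt.tendsto.comp hΦec
      rw [hm0] at this
      exact this.eventually (e.open_source.mem_nhds h1)
  obtain ⟨N0, hN0, hN0o, h1N0⟩ := eventually_nhds_iff.1 hp_ev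
  let p : G → V := fun g => (Φ.symm (e g)).1
  have hp1 : p 1 = 0 := by simp [p, ← hw0, hΦs0]
  let s : V → G := fun v => S v
  have hs0 : s 0 = 1 := hS0
  have hpN0 : ContMDiffOn 𝓘(ℂ, E) 𝓘(ℂ, V) ω p N0 := by
    intro g hg
    obtain ⟨hg1, -, hg3, -, -⟩ := hN0 g hg
    have : ContMDiffAt 𝓘(ℂ, E) 𝓘(ℂ, V) ω (fun x : E => (Φ.symm x).1) (e g) :=
      (contDiff_fst.contDiffAt.comp _ hg3).contMDiffAt
    exact (this.comp g (contMDiffAt_of_mem_maximalAtlas he hg1)).contMDiffWithinAt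
  have hsp : ∀ g ∈ N0, (s (p g) : G ⧸ H) = (g : G ⧸ H) := by
    intro g hg
    obtain ⟨hg1, hg2, -, hg4, hg5⟩ := hN0 g hg
    have h : m (Φ.symm (e g)) = g := e.injOn hg5 hg1 (Φ.right_inv hg2)
    rw [QuotientGroup.eq]
    have hk : (s (p g))⁻¹ * g = S (Φ.symm (e g)).2 := by
      rw [inv_mul_eq_iff_eq_mul]
      exact h.symm
    rw [hk]
    exact hSW _ hg4
  -- injectivity
  obtain ⟨ε, hε, hball⟩ := Metric.isOpen_iff.1 Φ.open_source 0 hΦ0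
  have hsc : ContinuousAt s 0 := by
    have : ContinuousAt S ((0 : V) : E) := by simpa using hSat.continuousAt
    exact this.comp (f := fun v : V => (v : E)) continuous_subtype_val.continuousAt
  have hinj_ev : ∀ᶠ q : V × V in 𝓝 (0, 0), (s q.1)⁻¹ * s q.2 ∈ e.source ∧
      ‖e ((s q.1)⁻¹ * s q.2) - w0‖ < ε := by
    have hc : Filter.Tendsto (fun q : V × V => (s q.1)⁻¹ * s q.2) (𝓝 (0, 0)) (𝓝 1) := by
      have h1' : ContinuousAt (fun q : V × V => s q.1) (0, 0) :=
        ContinuousAt.comp (g := s) (by exact hsc) continuousAt_fst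
      have h2' : ContinuousAt (fun q : V × V => s q.2) (0, 0) :=
        ContinuousAt.comp (g := s) (by exact hsc) continuousAt_snd
      have := (h1'.inv.mul h2').tendsto
      rw [show ((fun q : V × V => s q.1)⁻¹ * fun q : V × V => s q.2) (0, 0) = 1 by
        simp [hs0]] at this
      exact this
    refine (hc.eventually (e.open_source.mem_nhds h1)).and ?_
    have := (e.continuousAt h1).tendsto.comp hc
    have h3 := this.eventually (Metric.ball_mem_nhds _ hε)
    filter_upwards [h3] with q hq
    simpa [dist_eq_norm] using hq
  obtain ⟨A1, hA1, A2, hA2, hA12⟩ := mem_nhds_prod_iff.1 hinj_ev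
  have hA0ev : ∀ᶠ v : V in 𝓝 0, v ∈ A1 ∧ v ∈ A2 ∧ ‖v‖ < ε ∧ w0 + (v : E) ∈ e.target := by
    refine Filter.Eventually.and hA1 (Filter.Eventually.and hA2 (.and ?_ ?_))
    · filter_upwards [Metric.ball_mem_nhds (0 : V) hε] with v hv
      simpa using hv
    · exact (hTopen.preimage V.subtypeL.continuous).mem_nhds (by simpa using hw0t)
  obtain ⟨A0, hA0, hA0o, h0A0⟩ := eventually_nhds_iff.1 hA0ev
  have hinj : Set.InjOn (fun v => (s v : G ⧸ H)) A0 := by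
    intro v hv v' hv' hvv
    have hh : (s v)⁻¹ * s v' ∈ H := QuotientGroup.eq.1 hvv
    obtain ⟨hv1, hv2, hv3, hv4⟩ := hA0 v hv
    obtain ⟨hv1', hv2', hv3', hv4'⟩ := hA0 v' hv'
    obtain ⟨hsrc, hnorm⟩ := hA12 (show (v, v') ∈ A1 ×ˢ A2 from ⟨hv1, hv2'⟩)
    simp only at hsrc hnorm
    let w : W := ⟨e ((s v)⁻¹ * s v') - w0, W.sub_mem ((hW _ hsrc).1 hh) hw0W⟩
    have hSw : S w = (s v)⁻¹ * s v' := by simp [S, w, e.left_inv hsrc]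
    have e1 : F (v, w) = F (v', 0) := by
      have : m (v, w) = m (v', 0) := by
        change S v * S w = S v' * S ((0 : W) : E)
        rw [hSw]
        simp [s, hS0]
      simp only [F, this]
    have s1 : (v, w) ∈ Φ.source := by
      apply hball
      rw [mem_ball_zero_iff, Prod.norm_def]
      exact max_lt hv3 hnorm
    have s2 : (v', (0 : W)) ∈ Φ.source := by
      apply hball
      rw [mem_ball_zero_iff, Prod.norm_def]
      exact max_lt hv3' (by simpa using hε)
    exact congrArg Prod.fst (Φ.injOn s1 s2 e1)
  -- shrink
  let N : Set G := N0 ∩ p ⁻¹' A0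
  have hN : IsOpen N := hpN0.continuousOn.isOpen_inter_preimage hN0o hA0o
  have hsA0 : ContMDiffOn 𝓘(ℂ, V) 𝓘(ℂ, E) ω s A0 :=
    hSsm.comp (V.subtypeL.contDiff.contMDiff.contMDiffOn) (fun v hv => (hA0 v hv).2.2.2)
  refine ⟨V, A0 ∩ s ⁻¹' N, N, s, p, hsA0.continuousOn.isOpen_inter_preimage hA0o hN,
    ⟨h0A0, ?_⟩, hN, hs0, fun v hv => hv.2, hsA0.mono Set.inter_subset_left,
    hpN0.mono Set.inter_subset_left, hinj.mono Set.inter_subset_left,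
    fun g hg => hsp g hg.1, fun v hv => hinj hv.2.2 hv.1 (hsp _ hv.2.1)⟩
  change s 0 ∈ N
  rw [hs0]
  exact ⟨h1N0, by simpa [hp1] using h0A0⟩

/-- A chart of `G ⧸ H` around the base point, holomorphic after composition with the projection
`G → G ⧸ H`, whose inverse lifts to a holomorphic map to `G`. -/
theorem IsClosedComplexLieSubgroup.exists_chart (hH : IsClosedComplexLieSubgroup E H) :
    ∃ (V : Submodule ℂ E) (φ : OpenPartialHomeomorph (G ⧸ H) V) (s : V → G),
      ((1 : G) : G ⧸ H) ∈ φ.source ∧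
      ContMDiffOn 𝓘(ℂ, E) 𝓘(ℂ, V) ω (fun g : G => φ (g : G ⧸ H))
        ((fun g : G => (g : G ⧸ H)) ⁻¹' φ.source) ∧
      ContMDiffOn 𝓘(ℂ, V) 𝓘(ℂ, E) ω s φ.target ∧
      ∀ v ∈ φ.target, φ.symm v = (s v : G ⧸ H) := by
  have : IsTopologicalGroup G := topologicalGroup_of_lieGroup 𝓘(ℂ, E) ω
  obtain ⟨V, A, N, s, p, hA, h0, hN, hs0, hsN, hs, hp, hinj, hsp, hps⟩ := hH.exists_section
  have hcont : ContinuousOn (fun v => (s v : G ⧸ H)) A :=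
    QuotientGroup.continuous_mk.comp_continuousOn hs.continuousOn
  have hopen : IsOpenMap (A.domRestrict (fun v => (s v : G ⧸ H))) := by
    rw [isOpenMap_iff_nhds_le]
    rintro ⟨v, hv⟩ U hU
    rw [Filter.mem_map, nhds_subtype_eq_comap, Filter.mem_comap] at hU
    obtain ⟨B, hB, hBU⟩ := hU
    have hpc : ContinuousAt p (s v) :=
      (hp.continuousOn).continuousAt (hN.mem_nhds (hsN hv))
    have hBA : p ⁻¹' (B ∩ A) ∩ N ∈ 𝓝 (s v) := by
      refine Filter.inter_mem (hpc.preimage_mem_nhds ?_) (hN.mem_nhds (hsN hv))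
      rw [hps v hv]
      exact Filter.inter_mem hB (hA.mem_nhds hv)
    have := QuotientGroup.isOpenMap_coe (N := H) |>.image_mem_nhds hBA
    refine Filter.mem_of_superset this ?_
    rintro _ ⟨g, ⟨⟨hg1, hg2⟩, hg3⟩, rfl⟩
    have := hBU (show (⟨p g, hg2⟩ : A) ∈ _ from hg1)
    simp only [Set.mem_preimage, Set.domRestrict_apply] at this
    rwa [hsp g hg3] at this
  let ψ : OpenPartialHomeomorph V (G ⧸ H) :=
    OpenPartialHomeomorph.ofContinuousOpenRestrict (hinj.toPartialEquiv _ A) hcont hopen hA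
  have hψ : ∀ v, ψ v = (s v : G ⧸ H) := fun v => rfl
  have hψs : ψ.source = A := rfl
  refine ⟨V, ψ.symm, s, ?_, ?_, ?_, fun v _ => hψ v⟩
  · have := ψ.map_source (x := 0) h0
    rwa [hψ, hs0] at this
  · intro g hg
    have hv : ψ.symm (g : G ⧸ H) ∈ A := ψ.map_target hg
    set v := ψ.symm (g : G ⧸ H) with hvdef
    have hgv : (s v : G ⧸ H) = g := ψ.right_inv hg
    have hh : (s v)⁻¹ * g ∈ H := QuotientGroup.eq.1 hgv
    set h := (s v)⁻¹ * g with hdef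
    have hgh : g * h⁻¹ = s v := by simp [hdef]
    have hr : ContMDiffAt 𝓘(ℂ, E) 𝓘(ℂ, E) ω (fun x : G => x * h⁻¹) g :=
      (contMDiff_mul_right (a := h⁻¹)).contMDiffAt
    have hq : ContMDiffAt 𝓘(ℂ, E) 𝓘(ℂ, V) ω (fun x : G => p (x * h⁻¹)) g := by
      refine ContMDiffAt.comp (g := p) g ?_ hr
      rw [hgh]
      exact hp.contMDiffAt (hN.mem_nhds (hsN hv))
    refine (hq.congr_of_eventuallyEq ?_).contMDiffWithinAt
    have ev1 : ∀ᶠ x in 𝓝 g, x * h⁻¹ ∈ N :=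
      hr.continuousAt.preimage_mem_nhds (by rw [hgh]; exact hN.mem_nhds (hsN hv))
    have ev2 : ∀ᶠ x in 𝓝 g, p (x * h⁻¹) ∈ A :=
      hq.continuousAt.preimage_mem_nhds (by rw [hgh, hps v hv]; exact hA.mem_nhds hv)
    filter_upwards [ev1, ev2] with x hx1 hx2
    have hx : (x : G ⧸ H) = ψ (p (x * h⁻¹)) := by
      rw [hψ, hsp _ hx1]
      exact QuotientGroup.eq.2 (by simpa using H.inv_mem hh)
    rw [hx]
    exact ψ.left_inv hx2
  · exact hs

namespace IsClosedComplexLieSubgroup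

variable (hH : IsClosedComplexLieSubgroup E H)

/-- The model space of the complex manifold `G ⧸ H`: a complement in `E` of the tangent space
of `H` at the identity. -/
def model : Submodule ℂ E := hH.exists_chart.choose

/-- A holomorphic chart of `G ⧸ H` around the base point. -/
def baseChart : OpenPartialHomeomorph (G ⧸ H) hH.model := hH.exists_chart.choose_spec.choose

/-- A holomorphic lift to `G` of the inverse of the chart around the base point. -/
def baseSection : hH.model → G := hH.exists_chart.choose_spec.choose_spec.choose

theorem one_mem_baseChart_source : ((1 : G) : G ⧸ H) ∈ hH.baseChart.source :=
  hH.exists_chart.choose_spec.choose_spec.choose_spec.1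

theorem contMDiffOn_baseChart_mk :
    ContMDiffOn 𝓘(ℂ, E) 𝓘(ℂ, hH.model) ω (fun g : G => hH.baseChart (g : G ⧸ H))
      ((fun g : G => (g : G ⧸ H)) ⁻¹' hH.baseChart.source) :=
  hH.exists_chart.choose_spec.choose_spec.choose_spec.2.1

theorem contMDiffOn_baseSection :
    ContMDiffOn 𝓘(ℂ, hH.model) 𝓘(ℂ, E) ω hH.baseSection hH.baseChart.target :=
  hH.exists_chart.choose_spec.choose_spec.choose_spec.2.2.1

theorem baseChart_symm_eq {v : hH.model} (hv : v ∈ hH.baseChart.target) :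
    hH.baseChart.symm v = (hH.baseSection v : G ⧸ H) :=
  hH.exists_chart.choose_spec.choose_spec.choose_spec.2.2.2 v hv

/-- The translation of `G ⧸ H` by `g` as a homeomorphism. -/
def translate (H : Subgroup G) [IsTopologicalGroup G] (g : G) : (G ⧸ H) ≃ₜ (G ⧸ H) :=
  Homeomorph.smul g

/-- The translate by `g` of the chart around the base point, `x ↦ φ (g⁻¹ • x)`. -/
def chart (g : G) : OpenPartialHomeomorph (G ⧸ H) hH.model :=
  haveI : IsTopologicalGroup G := topologicalGroup_of_lieGroup 𝓘(ℂ, E) ω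
  (translate H g⁻¹).toOpenPartialHomeomorph.trans hH.baseChart

theorem chart_apply (g : G) (x : G ⧸ H) : hH.chart g x = hH.baseChart (g⁻¹ • x) := rfl

theorem mem_source_chart (g : G) (x : G ⧸ H) :
    x ∈ (hH.chart g).source ↔ g⁻¹ • x ∈ hH.baseChart.source := by
  simp [chart, translate]

theorem chart_target (g : G) : (hH.chart g).target = hH.baseChart.target := by
  simp [chart]

theorem chart_symm_apply (g : G) {v : hH.model} (hv : v ∈ hH.baseChart.target) :
    (hH.chart g).symm v = ((g * hH.baseSection v : G) : G ⧸ H) := by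
  have h : (hH.chart g).symm v = (g⁻¹)⁻¹ • hH.baseChart.symm v := rfl
  rw [h, hH.baseChart_symm_eq hv, inv_inv]
  rfl

/-- The holomorphic atlas of `G ⧸ H` (with the quotient topology) that consists of the translates
of the chart around the base point. -/
@[reducible]
def chartedSpace : ChartedSpace hH.model (G ⧸ H) where
  atlas := Set.range hH.chart
  chartAt x := hH.chart x.out
  mem_chart_source x := by
    rw [mem_source_chart]
    have h : x.out⁻¹ • x = ((1 : G) : G ⧸ H) := by
      conv_lhs => rw [← QuotientGroup.out_eq' x]
      change ((_ * _ : G) : G ⧸ H) = _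
      simp
    rw [h]
    exact hH.one_mem_baseChart_source
  chart_mem_atlas x := ⟨_, rfl⟩

/-- `G ⧸ H` is a complex manifold. -/
theorem isManifold :
    letI := hH.chartedSpace
    IsManifold 𝓘(ℂ, hH.model) ω (G ⧸ H) := by
  letI := hH.chartedSpace
  refine isManifold_of_contDiffOn _ _ _ ?_
  rintro _ _ ⟨g, rfl⟩ ⟨g', rfl⟩
  simp only [modelWithCornersSelf_coe, modelWithCornersSelf_coe_symm, Function.comp_id,
    Function.id_comp, Set.range_id, Set.inter_univ, Set.preimage_id]
  have key : ∀ v ∈ ((hH.chart g).symm ≫ₕ hH.chart g').source, v ∈ hH.baseChart.target ∧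
      ((g'⁻¹ * (g * hH.baseSection v) : G) : G ⧸ H) ∈ hH.baseChart.source := by
    intro v hv
    rw [OpenPartialHomeomorph.trans_source, OpenPartialHomeomorph.symm_source, chart_target] at hv
    refine ⟨hv.1, ?_⟩
    have h2 := hv.2
    rw [Set.mem_preimage, hH.chart_symm_apply g hv.1, mem_source_chart] at h2
    exact h2
  have hsm : ContMDiffOn 𝓘(ℂ, hH.model) 𝓘(ℂ, hH.model) ω
      (fun v => hH.baseChart ((g'⁻¹ * (g * hH.baseSection v) : G) : G ⧸ H))
      ((hH.chart g).symm ≫ₕ hH.chart g').source := by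
    refine hH.contMDiffOn_baseChart_mk.comp (f := fun v => g'⁻¹ * (g * hH.baseSection v)) ?_
      (fun v hv => (key v hv).2)
    exact contMDiffOn_const.mul (contMDiffOn_const.mul
      (hH.contMDiffOn_baseSection.mono fun v hv => (key v hv).1))
  refine (contMDiffOn_iff_contDiffOn.1 hsm).congr ?_
  intro v hv
  change hH.chart g' ((hH.chart g).symm v) = _
  rw [hH.chart_symm_apply g (key v hv).1]
  rfl

/-- The projection `G → G ⧸ H` is holomorphic. (It is a submersion, since it has the local
holomorphic sections `v ↦ g * hH.baseSection v` in the charts of `G ⧸ H`.) -/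
theorem contMDiff_mk :
    letI := hH.chartedSpace
    ContMDiff 𝓘(ℂ, E) 𝓘(ℂ, hH.model) ω (fun g : G => (g : G ⧸ H)) := by
  letI := hH.chartedSpace
  have : IsTopologicalGroup G := topologicalGroup_of_lieGroup 𝓘(ℂ, E) ω
  intro g
  rw [contMDiffAt_iff_target]
  refine ⟨QuotientGroup.continuous_mk.continuousAt, ?_⟩
  have hmem := mem_chart_source hH.model (g : G ⧸ H)
  set a : G := (g : G ⧸ H).out with ha
  change (g : G ⧸ H) ∈ (hH.chart a).source at hmem
  rw [hH.mem_source_chart] at hmem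
  have hopen : IsOpen ((fun g : G => (g : G ⧸ H)) ⁻¹' hH.baseChart.source) :=
    hH.baseChart.open_source.preimage QuotientGroup.continuous_mk
  have h1 := hH.contMDiffOn_baseChart_mk.contMDiffAt (x := a⁻¹ * g) (hopen.mem_nhds hmem)
  exact ContMDiffAt.comp (f := fun x : G => a⁻¹ * x) g h1
    (contMDiff_mul_left (a := a⁻¹)).contMDiffAt

end IsClosedComplexLieSubgroup

end Quotient

end

/-! Since `G` acts transitively, an equivariant `μ` is determined by its value `g H` at the base
point: `μ (x H) = σ(x) g H`. The stabilizers of `H` and `g H` are `H` and `g H g⁻¹`, and an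
injective equivariant map matches stabilizers through `σ`, so `σ(H) = g H g⁻¹`
(`map_eq_map_conj_of_equivariant`). Conversely, this equality makes `x H ↦ σ(x) g H` well defined.
Its square is `x H ↦ x σ(g) g H`, and `σ(g) g` normalizes `H` (`map_mul_self_mem_normalizer`), so
the map is an involution when `N(H) = H`. Two possible base values `a H`, `b H` satisfy `a⁻¹ b ∈
N(H) = H`, whence uniqueness. Antiholomorphy is local: with a holomorphic local section `ℓ` of `G →
G ⧸ H`, the map is `q ∘ σ ∘ ℓ` where `q x = x g H` is holomorphic. -/

noncomputable section

/-! ### Holomorphic maps viewed as real smooth maps. -/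

section RestrictScalars

variable {E F : Type*} [NormedAddCommGroup E] [NormedSpace ℂ E]
  [NormedAddCommGroup F] [NormedSpace ℂ F]
  {M N : Type*} [TopologicalSpace M] [ChartedSpace E M] [TopologicalSpace N] [ChartedSpace F N]
  {f : M → N} {x : M}

/-- A `C^n` map of complex manifolds is `C^n` as a map of the underlying real manifolds. -/
theorem ContMDiffAt.complexToReal {n : WithTop ℕ∞} (hf : ContMDiffAt 𝓘(ℂ, E) 𝓘(ℂ, F) n f x) :
    ContMDiffAt 𝓘(ℝ, E) 𝓘(ℝ, F) n f x := by
  rw [contMDiffAt_iff] at hf ⊢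
  -- Both models have the same extended charts, so only the scalars of the coordinate expression
  -- change.
  exact ⟨hf.1, hf.2.restrict_scalars ℝ⟩

/-- The complex derivative of a map of complex manifolds, with scalars restricted to `ℝ`, is its
real derivative. -/
theorem HasMFDerivAt.complexToReal {f' : E →L[ℂ] F}
    (hf : HasMFDerivAt 𝓘(ℂ, E) 𝓘(ℂ, F) f x f') :
    HasMFDerivAt 𝓘(ℝ, E) 𝓘(ℝ, F) f x (f'.restrictScalars ℝ) :=
  ⟨hf.1, HasFDerivWithinAt.restrictScalars ℝ hf.2⟩

theorem realDifferential_I_smul_of_mdifferentiableAt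
    (hf : MDifferentiableAt 𝓘(ℂ, E) 𝓘(ℂ, F) f x) (v : E) :
    realDifferential E F f x (Complex.I • v) = Complex.I • realDifferential E F f x v := by
  have h : realDifferential E F f x =
      ContinuousLinearMap.restrictScalars ℝ (mfderiv 𝓘(ℂ, E) 𝓘(ℂ, F) f x : E →L[ℂ] F) :=
    (HasMFDerivAt.complexToReal hf.hasMFDerivAt).mfderiv
  rw [h]
  exact ContinuousLinearMap.map_smul (mfderiv 𝓘(ℂ, E) 𝓘(ℂ, F) f x : E →L[ℂ] F) Complex.I v

end RestrictScalars

/-! ### Antiholomorphy of composites. -/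

section Composition

variable {E₁ E₂ E₃ : Type*} [NormedAddCommGroup E₁] [NormedSpace ℂ E₁]
  [NormedAddCommGroup E₂] [NormedSpace ℂ E₂] [NormedAddCommGroup E₃] [NormedSpace ℂ E₃]
  {M₁ M₂ M₃ : Type*} [TopologicalSpace M₁] [ChartedSpace E₁ M₁]
  [TopologicalSpace M₂] [ChartedSpace E₂ M₂] [TopologicalSpace M₃] [ChartedSpace E₃ M₃]

theorem realDifferential_comp {f : M₁ → M₂} {g : M₂ → M₃} {x : M₁}
    (hg : MDifferentiableAt 𝓘(ℝ, E₂) 𝓘(ℝ, E₃) g (f x))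
    (hf : MDifferentiableAt 𝓘(ℝ, E₁) 𝓘(ℝ, E₂) f x) (v : E₁) :
    realDifferential E₁ E₃ (g ∘ f) x v =
      realDifferential E₂ E₃ g (f x) (realDifferential E₁ E₂ f x v) := by
  unfold realDifferential
  rw [mfderiv_comp x hg hf]
  rfl

/-- A map that locally is of the form `q ∘ σ ∘ ℓ` with `σ` antiholomorphic and `q`, `ℓ`
holomorphic is antiholomorphic. -/
theorem IsAntiholomorphic.of_eventuallyEq_comp {E₀ M₀ : Type*} [NormedAddCommGroup E₀]
    [NormedSpace ℂ E₀] [TopologicalSpace M₀] [ChartedSpace E₀ M₀] {σ : M₁ → M₂}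
    (hσ : IsAntiholomorphic E₁ E₂ σ) {q : M₂ → M₃} (hq : ContMDiff 𝓘(ℂ, E₂) 𝓘(ℂ, E₃) ω q)
    {μ : M₀ → M₃}
    (h : ∀ x, ∃ ℓ : M₀ → M₁, ContMDiffAt 𝓘(ℂ, E₀) 𝓘(ℂ, E₁) ω ℓ x ∧ μ =ᶠ[𝓝 x] q ∘ σ ∘ ℓ) :
    IsAntiholomorphic E₀ E₃ μ := by
  refine ⟨fun x => ?_, fun x v => ?_⟩ <;> obtain ⟨ℓ, hℓ, hμ⟩ := h x
  · refine ContMDiffAt.congr_of_eventuallyEq ?_ hμ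
    exact ((hq (σ (ℓ x))).complexToReal.of_le le_top).comp x
      ((hσ.1 (ℓ x)).comp x (hℓ.complexToReal.of_le le_top))
  · have hℓd : MDifferentiableAt 𝓘(ℝ, E₀) 𝓘(ℝ, E₁) ℓ x :=
      hℓ.complexToReal.mdifferentiableAt (by simp)
    have hσd : MDifferentiableAt 𝓘(ℝ, E₁) 𝓘(ℝ, E₂) σ (ℓ x) :=
      (hσ.1 (ℓ x)).mdifferentiableAt (by simp)
    have hqd : MDifferentiableAt 𝓘(ℝ, E₂) 𝓘(ℝ, E₃) q (σ (ℓ x)) :=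
      (hq (σ (ℓ x))).complexToReal.mdifferentiableAt (by simp)
    have key : ∀ w, realDifferential E₀ E₃ μ x w = realDifferential E₂ E₃ q (σ (ℓ x))
        (realDifferential E₁ E₂ σ (ℓ x) (realDifferential E₀ E₁ ℓ x w)) := fun w => by
      have hcongr : realDifferential E₀ E₃ μ x w = realDifferential E₀ E₃ (q ∘ σ ∘ ℓ) x w := by
        have h' := (hqd.comp x (hσd.comp x hℓd)).hasMFDerivAt.congr_of_eventuallyEq hμ
        exact congrArg (fun L : E₀ →L[ℝ] E₃ => L w) h'.mfderiv
      rw [hcongr, realDifferential_comp (f := σ ∘ ℓ) (g := q) hqd (hσd.comp x hℓd),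
        realDifferential_comp hσd hℓd]
      rfl
    -- The factor `I` commutes with the differentials of `ℓ` and `q` and changes sign once, at `σ`.
    rw [key, key, realDifferential_I_smul_of_mdifferentiableAt (hℓ.mdifferentiableAt (by simp)),
      hσ.2, map_neg, realDifferential_I_smul_of_mdifferentiableAt
        ((hq (σ (ℓ x))).mdifferentiableAt (by simp))]

end Composition

/-! ### Local sections of the projection. -/

/-- The projection `G → G ⧸ H` has local holomorphic sections around every point. -/
theorem IsClosedComplexLieSubgroup.exists_local_section {E : Type*} [NormedAddCommGroup E]
    [NormedSpace ℂ E] [FiniteDimensional ℂ E] {G : Type*} [Group G] [TopologicalSpace G]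
    [ChartedSpace E G] [LieGroup 𝓘(ℂ, E) ω G] {H : Subgroup G}
    (hH : IsClosedComplexLieSubgroup E H) (x : G ⧸ H) :
    letI := hH.chartedSpace
    ∃ ℓ : G ⧸ H → G, ContMDiffAt 𝓘(ℂ, hH.model) 𝓘(ℂ, E) ω ℓ x ∧
      ∀ᶠ y in 𝓝 x, ((ℓ y : G) : G ⧸ H) = y := by
  let := hH.chartedSpace
  have := hH.isManifold
  have hx : x ∈ (hH.chart x.out).source := mem_chart_source hH.model x
  have hchart : ContMDiffAt 𝓘(ℂ, hH.model) 𝓘(ℂ, hH.model) ω (hH.chart x.out) x :=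
    (contMDiffOn_chart (I := 𝓘(ℂ, hH.model)) (n := ω) (x := x)).contMDiffAt
      ((hH.chart x.out).open_source.mem_nhds hx)
  have htarget : ∀ y ∈ (hH.chart x.out).source, hH.chart x.out y ∈ hH.baseChart.target :=
    fun y hy => hH.chart_target x.out ▸ (hH.chart x.out).map_source hy
  -- The chart at `x` is the base chart translated by `x.out`, so translating `baseSection` by
  -- `x.out` lifts its inverse.
  refine ⟨fun y => x.out * hH.baseSection (hH.chart x.out y), ?_, ?_⟩
  · refine contMDiffAt_const.mul (ContMDiffAt.comp (g := hH.baseSection) x ?_ hchart)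
    exact hH.contMDiffOn_baseSection.contMDiffAt
      (hH.baseChart.open_target.mem_nhds (htarget x hx))
  · filter_upwards [(hH.chart x.out).open_source.mem_nhds hx] with y hy
    rw [← hH.chart_symm_apply _ (htarget y hy), (hH.chart x.out).left_inv hy]

/-! ### Equivariant self-maps of `G ⧸ H` and conjugates of `H`. -/

section Equivariant

variable {G : Type*} [Group G] {H : Subgroup G} {σ : G →* G}

theorem mem_map_conj_iff {g x : G} :
    x ∈ H.map (MulAut.conj g).toMonoidHom ↔ g⁻¹ * x * g ∈ H := by
  constructor
  · rintro ⟨h, hh, rfl⟩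
    simpa [mul_assoc] using hh
  · exact fun h => ⟨_, h, by simp [mul_assoc]⟩

/-- As `σ` is bijective, every element of `G` is some `σ h`, and it lies in `σ(H)` exactly when `h ∈
H`. This elementwise form can be iterated. -/
theorem map_eq_map_conj_iff (hσ : Function.Involutive σ) {g : G} :
    H.map σ = H.map (MulAut.conj g).toMonoidHom ↔ ∀ h, h ∈ H ↔ g⁻¹ * σ h * g ∈ H := by
  have hmem : ∀ x, σ x ∈ H.map σ ↔ x ∈ H := fun x => Subgroup.mem_map_iff_mem hσ.injective
  constructor
  · intro h x
    rw [← hmem x, h, mem_map_conj_iff]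
  · intro h
    ext x
    rw [mem_map_conj_iff, ← hσ x, hmem, hσ x, h, hσ x]

theorem smul_mk_eq_mk_iff {g h : G} : h • (g : G ⧸ H) = (g : G ⧸ H) ↔ g⁻¹ * h * g ∈ H := by
  rw [eq_comm]
  change (g : G ⧸ H) = ((h * g : G) : G ⧸ H) ↔ _
  rw [QuotientGroup.eq, mul_assoc]

/-- If an injective self-map `μ` of `G ⧸ H` is `σ`-equivariant and sends the base point to `g H`,
then `σ H = g H g⁻¹`. -/
theorem map_eq_map_conj_of_equivariant (hσ : Function.Involutive σ) {μ : G ⧸ H → G ⧸ H}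
    (hμ : Function.Injective μ) (hequiv : ∀ (g : G) (x : G ⧸ H), μ (g • x) = σ g • μ x)
    {g : G} (hg : μ ((1 : G) : G ⧸ H) = (g : G ⧸ H)) :
    H.map σ = H.map (MulAut.conj g).toMonoidHom := by
  refine (map_eq_map_conj_iff hσ).2 fun h => ?_
  -- `σ h` fixes `μ(H) = g H` iff `μ (h • H) = μ(H)`, iff `h` fixes the base point.
  rw [← smul_mk_eq_mk_iff, ← hg, ← hequiv, hμ.eq_iff, smul_mk_eq_mk_iff]
  simp

theorem inv_mul_mem_normalizer_of_map_conj_eq {g g' : G}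
    (h : H.map (MulAut.conj g).toMonoidHom = H.map (MulAut.conj g').toMonoidHom) :
    g⁻¹ * g' ∈ Subgroup.normalizer (H : Set G) := by
  rw [Subgroup.mem_normalizer_iff]
  intro x
  -- The test element lies in `g' H g'⁻¹` exactly when `x ∈ H`.
  have := SetLike.ext_iff.1 h (g' * x * g'⁻¹)
  rw [mem_map_conj_iff, mem_map_conj_iff] at this
  simpa [mul_assoc] using this.symm

/-- Applying `σ` to `σ(H) = g H g⁻¹` gives `H = σ(g) g H (σ(g) g)⁻¹`. -/
theorem map_mul_self_mem_normalizer (hσ : Function.Involutive σ) {g : G}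
    (hg : H.map σ = H.map (MulAut.conj g).toMonoidHom) :
    σ g * g ∈ Subgroup.normalizer (H : Set G) := by
  rw [map_eq_map_conj_iff hσ] at hg
  -- Using the criterion twice conjugates by `(σ g * g)⁻¹`, so the inverse is the convenient
  -- element.
  rw [← inv_mem_iff, Subgroup.mem_normalizer_iff]
  intro x
  rw [hg x, hg (g⁻¹ * σ x * g)]
  simp [mul_assoc, hσ x]

/-- The map `x H ↦ σ(x) g H`, for `σ H ⊆ g H g⁻¹`. -/
def twistedQuotientMap (σ : G →* G) (g : G) (hg : ∀ h ∈ H, g⁻¹ * σ h * g ∈ H) : G ⧸ H → G ⧸ H :=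
  Quotient.lift (fun x => ((σ x * g : G) : G ⧸ H)) fun a b hab => by
    rw [QuotientGroup.eq]
    simpa [mul_assoc] using hg _ (QuotientGroup.leftRel_apply.1 hab)

theorem twistedQuotientMap_mk {g : G} (hg : ∀ h ∈ H, g⁻¹ * σ h * g ∈ H) (x : G) :
    twistedQuotientMap σ g hg (x : G ⧸ H) = ((σ x * g : G) : G ⧸ H) := rfl

theorem twistedQuotientMap_smul {g : G} (hg : ∀ h ∈ H, g⁻¹ * σ h * g ∈ H) (a : G) (x : G ⧸ H) :
    twistedQuotientMap σ g hg (a • x) = σ a • twistedQuotientMap σ g hg x := by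
  induction x using QuotientGroup.induction_on with
  | H x =>
    change ((σ (a * x) * g : G) : G ⧸ H) = ((σ a * (σ x * g) : G) : G ⧸ H)
    rw [map_mul, mul_assoc]

theorem twistedQuotientMap_involutive (hσ : Function.Involutive σ) {g : G}
    (hg : ∀ h ∈ H, g⁻¹ * σ h * g ∈ H) (hgg : σ g * g ∈ H) :
    Function.Involutive (twistedQuotientMap σ g hg) := by
  intro x
  induction x using QuotientGroup.induction_on with
  | H x =>
    rw [twistedQuotientMap_mk, twistedQuotientMap_mk, eq_comm, QuotientGroup.eq, map_mul, hσ]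
    simpa [mul_assoc] using hgg

end Equivariant

end

/-! ### Necessity, existence and uniqueness. -/

theorem mainTheorem3
    {E : Type*} [NormedAddCommGroup E] [NormedSpace ℂ E] [FiniteDimensional ℂ E]
    {G : Type*} [Group G] [TopologicalSpace G] [ChartedSpace E G] [LieGroup 𝓘(ℂ, E) ω G]
    (σ : G →* G) (hσ : IsAntiholomorphic E E σ) (hσ_inv : Function.Involutive σ)
    (H : Subgroup G) (hH : IsClosedComplexLieSubgroup E H) :
    letI := hH.chartedSpace
    ((∃ μ : G ⧸ H → G ⧸ H, IsEquivariantRealStructure hH.model σ μ) →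
      ∃ g : G, H.map σ = H.map (MulAut.conj g).toMonoidHom) ∧
    ((∃ g : G, H.map σ = H.map (MulAut.conj g).toMonoidHom) →
      Subgroup.normalizer (H : Set G) = H →
      ∃! μ : G ⧸ H → G ⧸ H, IsEquivariantRealStructure hH.model σ μ) := by
  let := hH.chartedSpace
  -- The conjugating element is kept tied to the base value of `μ`, since uniqueness compares these
  -- values.
  have hconj : ∀ {μ : G ⧸ H → G ⧸ H}, IsEquivariantRealStructure hH.model σ μ →
      ∃ g : G, μ ((1 : G) : G ⧸ H) = (g : G ⧸ H) ∧
        H.map σ = H.map (MulAut.conj g).toMonoidHom := fun {μ} hμ => by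
    obtain ⟨g, hg⟩ := QuotientGroup.mk_surjective (μ ((1 : G) : G ⧸ H))
    exact ⟨g, hg.symm, map_eq_map_conj_of_equivariant hσ_inv hμ.involutive.injective
      hμ.equivariant hg.symm⟩
  refine ⟨fun ⟨μ, hμ⟩ => (hconj hμ).imp fun _ h => h.2, fun ⟨g, hg⟩ hN => ?_⟩
  refine existsUnique_of_exists_of_unique ?_ ?_
  · have hgH : ∀ h ∈ H, g⁻¹ * σ h * g ∈ H := fun h =>
      ((map_eq_map_conj_iff hσ_inv).1 hg h).1
    refine ⟨twistedQuotientMap σ g hgH, ⟨⟨?_, ?_⟩, twistedQuotientMap_smul hgH⟩⟩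
    · refine hσ.of_eventuallyEq_comp (q := fun x : G => ((x * g : G) : G ⧸ H))
        (hH.contMDiff_mk.comp contMDiff_mul_right) fun x => ?_
      obtain ⟨ℓ, hℓ, hℓx⟩ := hH.exists_local_section x
      refine ⟨ℓ, hℓ, ?_⟩
      filter_upwards [hℓx] with y hy
      conv_lhs => rw [← hy]
      rfl
    · exact twistedQuotientMap_involutive hσ_inv hgH
        (hN.le (map_mul_self_mem_normalizer hσ_inv hg))
  · intro μ μ' hμ hμ'
    obtain ⟨a, ha, hac⟩ := hconj hμ
    obtain ⟨b, hb, hbc⟩ := hconj hμ'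
    have hab : μ ((1 : G) : G ⧸ H) = μ' ((1 : G) : G ⧸ H) := by
      rw [ha, hb, QuotientGroup.eq]
      exact hN.le (inv_mul_mem_normalizer_of_map_conj_eq (hac.symm.trans hbc))
    -- By transitivity, agreement at the base point spreads to all of `G ⧸ H`.
    funext x
    obtain ⟨c, rfl⟩ := QuotientGroup.mk_surjective x
    have hc : (c : G ⧸ H) = c • ((1 : G) : G ⧸ H) := by
      change _ = ((c * 1 : G) : G ⧸ H)
      rw [mul_one]
    change μ (c : G ⧸ H) = μ' (c : G ⧸ H)
    rw [hc, hμ.equivariant, hμ'.equivariant, hab]
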